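/- Definitions. A representation of a topological space $X$ is a surjection $\delta\colon D\to X$ with $D\subseteq\mathcal N=\omega^\omega$ (the Baire space). It is admissible if it is continuous and every continuous $\nu\colon Z\to X$ with $Z\subseteq\mathcal N$ is of the form $\nu=\delta\circ g$ for some continuous $g\colon Z\to D$. Put $EQ(\delta)=\{(p,q)\in D\times D : \delta(p)=\delta(q)\}$. A qcb$_0$-space is a $T_0$-space that is a topological quotient of a space with a countable basis; $\mathsf{QCB_0}$ is the category of qcb$_0$-spaces and continuous functions. For every topological space $Y$, the classes $\mathbf\Sigma^1_\alpha(Y)$ ($\alpha<\omega_1$) are defined by recursion: $\mathbf\Sigma^1_0(Y)=\mathbf\Sigma^0_2(Y)$ is the class of countable unions of differences of open subsets of $Y$; $\mathbf\Sigma^1_{\alpha+1}(Y)$ consists of the projections to $Y$ of the complements of sets in $\mathbf\Sigma^1_\alpha(\mathcal N\times Y)$; and, for a limit ordinal $\lambda$, $\mathbf\Sigma^1_\lambda(Y)$ consists of the projections to $Y$ of the countable intersections of sets in $\bigcup_{\alpha<\lambda}\mathbf\Sigma^1_\alpha(\mathcal N\times Y)$. Let $\mathsf{QCB_0}(\mathbf\Sigma^1_\alpha)$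 be the class of qcb$_0$-spaces that have an admissible representation $\delta$ with $EQ(\delta)\in\mathbf\Sigma^1_\alpha(\mathcal N\times\mathcal N)$. A full subcategory $\mathsf C$ of $\mathsf{QCB_0}$ inherits countable products from $\mathsf{QCB_0}$ if every countable family of objects of $\mathsf C$ has a product in $\mathsf{QCB_0}$ that is an object of $\mathsf C$. Statement. There is no full subcategory $\mathsf C$ of $\mathsf{QCB_0}$ such that $\mathsf C$ is cartesian closed, inherits countable products from $\mathsf{QCB_0}$, contains the discrete space $\omega$ of natural numbers (up to homeomorphism), and is contained in $\mathsf{QCB_0}(\mathbf\Sigma^1_\alpha)$ for some $\alpha<\omega_1$. -/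

import Mathlib

open CategoryTheory CategoryTheory.Limits

universe u

noncomputable section

namespace QCBHierarchy

/-- The Baire space `ω^ω` with the product of the discrete topologies. -/
abbrev Baire : Type := ℕ → ℕ

/-! ### Families of pointclasses and the hyperprojective hierarchy of sets -/

/-- An assignment of a collection of subsets to every topological space. -/
abbrev SetFamily : Type (u + 1) := ∀ (X : Type u) [TopologicalSpace X], Set (Set X)

namespace SetFamily

/-- The family of all open sets. -/
def opens : SetFamily.{u} := fun _ _ => {A | IsOpen A}

/-- Countable unions of sets of the family. -/
def countableUnions (Γ : SetFamily.{u}) : SetFamily.{u} := fun X _ =>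
  {A | ∃ B : ℕ → Set X, (∀ n, B n ∈ Γ X) ∧ A = ⋃ n, B n}

/-- Countable intersections of sets of the family. -/
def countableInters (Γ : SetFamily.{u}) : SetFamily.{u} := fun X _ =>
  {A | ∃ B : ℕ → Set X, (∀ n, B n ∈ Γ X) ∧ A = ⋂ n, B n}

/-- Complements of sets of the family. -/
def compls (Γ : SetFamily.{u}) : SetFamily.{u} := fun X _ => {A | Aᶜ ∈ Γ X}

/-- Differences of sets of the family. -/
def diffs (Γ : SetFamily.{u}) : SetFamily.{u} := fun X _ =>
  {A | ∃ B ∈ Γ X, ∃ C ∈ Γ X, A = B \ C}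

/-- Projections to `X` of sets of the family in `Baire × X`. -/
def projections (Γ : SetFamily.{u}) : SetFamily.{u} := fun X _ =>
  {A | ∃ B ∈ Γ (Baire × X), A = {x | ∃ p : Baire, (p, x) ∈ B}}

end SetFamily

/-- The Borel class `Σ⁰₂`, in the form that is appropriate for arbitrary topological spaces:
countable unions of differences of open sets. -/
def sigmaZeroTwo : SetFamily.{u} := SetFamily.opens.diffs.countableUnions

/-- The levels `Σ¹_α` of the hyperprojective hierarchy: `Σ¹_0 = Σ⁰₂`, the level `Σ¹_{α+1}`
consists of the projections of complements of `Σ¹_α` sets, and for a limit ordinal `l` the level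
`Σ¹_l` consists of the projections of countable intersections of sets from `⋃_{α<l} Σ¹_α`. -/
def sigmaOne (α : Ordinal.{0}) : SetFamily.{u} :=
  Ordinal.limitRecOn α
    sigmaZeroTwo
    (fun _ Γ => Γ.compls.projections)
    (fun l _ Γ => SetFamily.projections (SetFamily.countableInters
      (fun X _ => ⋃ (a : Ordinal.{0}) (h : a < l), Γ a h X)))

theorem sigmaOne_zero : sigmaOne.{u} 0 = sigmaZeroTwo :=
  Ordinal.limitRecOn_zero _ _ _

theorem sigmaOne_add_one (α : Ordinal.{0}) :
    sigmaOne.{u} (α + 1) = (sigmaOne.{u} α).compls.projections :=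
  Ordinal.limitRecOn_add_one _ _ _ _

theorem sigmaOne_limit (l : Ordinal.{0}) (hl : Order.IsSuccLimit l) :
    sigmaOne.{u} l = SetFamily.projections (SetFamily.countableInters
      (fun X _ => ⋃ (a : Ordinal.{0}) (_ : a < l), sigmaOne.{u} a X)) :=
  Ordinal.limitRecOn_limit _ _ _ _ hl

/-! ### Admissible representations -/

/-- `δ`, a map defined on the subspace `D` of the Baire space, is an admissible representation
of `X`: it is a continuous surjection, and every continuous map `ν` into `X` from a subspace `Z`
of the Baire space factors as `ν = δ ∘ g` with `g` continuous. -/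
structure IsAdmissibleRep {X : Type u} [TopologicalSpace X] (D : Set Baire) (δ : D → X) :
    Prop where
  surjective : Function.Surjective δ
  continuous : Continuous δ
  universal : ∀ (Z : Set Baire) (ν : Z → X), Continuous ν →
    ∃ g : Z → D, Continuous g ∧ ν = δ ∘ g

/-- `EQ(δ)`: the set of the pairs of names in the domain of `δ` that denote the same point. -/
def eqSet {X : Type u} (D : Set Baire) (δ : D → X) : Set (Baire × Baire) :=
  {r | ∃ (hp : r.1 ∈ D) (hq : r.2 ∈ D), δ ⟨r.1, hp⟩ = δ ⟨r.2, hq⟩}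

/-- `X` is `Γ`-representable: it has an admissible representation `δ` with
`EQ(δ) ∈ Γ(Baire × Baire)`. -/
def IsRepresentable (Γ : SetFamily.{0}) (X : Type u) [TopologicalSpace X] : Prop :=
  ∃ (D : Set Baire) (δ : D → X), IsAdmissibleRep D δ ∧ eqSet D δ ∈ Γ (Baire × Baire)

/-! ### The category of qcb₀-spaces -/

/-- A qcb₀-space: a `T₀` space that is a topological quotient of a countably based space. -/
def isQCB0 : ObjectProperty TopCat.{u} := fun X =>
  T0Space X ∧ ∃ (Z : Type u) (_ : TopologicalSpace Z) (q : Z → X),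
    SecondCountableTopology Z ∧ Topology.IsQuotientMap q

/-- The category of qcb₀-spaces and continuous functions. -/
abbrev QCB0 : Type (u + 1) := isQCB0.{u}.FullSubcategory

/-- A category is cartesian closed: it has finite products, and for every object `X` the functor
"product with `X`" has a right adjoint, the exponential. -/
def IsCartesianClosed (𝒟 : Type*) [Category 𝒟] : Prop :=
  ∃ _ : CartesianMonoidalCategory 𝒟, Nonempty (MonoidalClosed 𝒟)

/-- The full subcategory of `QCB0` on the objects satisfying `C` inherits countable products from
`QCB0`: every countable family of its objects has a product in `QCB0` which is an object of it. -/
def InheritsCountableProducts (C : ObjectProperty QCB0.{u}) : Prop :=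
  ∀ (J : Type) [Countable J] (X : J → QCB0.{u}), (∀ j, C (X j)) →
    ∃ P : Fan X, Nonempty (IsLimit P) ∧ C P.pt

/-- The full subcategory contains the discrete space of natural numbers (up to homeomorphism). -/
def ContainsNat (C : ObjectProperty QCB0.{u}) : Prop :=
  ∃ X : QCB0.{u}, C X ∧ Nonempty (X.obj ≃ₜ ℕ)

/-- The class of all `Γ`-representable qcb₀-spaces. -/
def representableQCB0 (Γ : SetFamily.{0}) : ObjectProperty QCB0.{u} := fun X =>
  IsRepresentable Γ X.obj

end QCBHierarchy

end

namespace QCBHierarchy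

open TopologicalSpace

/-! ### Classes of spaces closed under countable products and function spaces -/

/-! Diagonalisation. Let `S` be the class of spaces underlying `C`, and consider the sets `{z | ∃ y,
G (z, y) = 0}` with `Y` in `S` and `G` continuous into `Baire`. Countable products give countable
intersections and projections along `Baire`; function spaces give complements (`compl_mem`). Hence
this family contains a universal set for every `Σ¹_α`, `α < ω₁` (`HasUniversal.sigmaOne`). If all
spaces in `S` were `Σ¹_α`-representable, quantifying over `Y` would amount to quantifying over names
`p` with `(p, p) ∈ EQ(δ)` subject to a closed condition. So one set `W` of the family would have
every member of the family on `Baire` as a section, and the complement of its diagonal would be a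
section of `W`, which is absurd. -/

/-- A class of separable spaces which contains `ℕ` and is closed under countable products and
under the formation of spaces of continuous functions into `ℕ`, in a weak sense: products are only
known up to a continuous surjection, and evaluation only has to be separately continuous. -/
structure IsFunctionSpaceClass (S : ObjectProperty TopCat.{u}) : Prop where
  separable : ∀ X, S X → SeparableSpace X
  nat : ∃ X, S X ∧ Nonempty (X ≃ₜ ℕ)
  pi : ∀ (J : Type) [Countable J] (X : J → TopCat.{u}), (∀ j, S (X j)) →
    ∃ P, S P ∧ ∃ π : P → ∀ j, X j,
      (∀ j, Continuous fun p => π p j) ∧ Function.Surjective π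
  functions : ∀ Y, S Y → ∃ E, S E ∧ ∃ ev : E → Y → ℕ, (∀ F, Continuous (ev F)) ∧
    (∀ y, Continuous fun F => ev F y) ∧ ∀ f : Y → ℕ, Continuous f → ∃ F, ev F = f

/-- The projections along a nonempty space of the class `S` of the zero sets of continuous
functions with values in the Baire space. -/
def zeroProjections (S : ObjectProperty TopCat.{u}) : SetFamily.{0} := fun Z _ =>
  {A | ∃ Y : TopCat.{u}, S Y ∧ Nonempty Y ∧ ∃ G : Z × Y → Baire, Continuous G ∧
    A = {z | ∃ y, G (z, y) = 0}}

theorem continuous_baire_eval : Continuous fun r : Baire × ℕ => r.1 r.2 :=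
  continuous_prod_of_discrete_right.2 fun n => continuous_apply n

/-! ### Closure properties of projections of zero sets -/

namespace IsFunctionSpaceClass

variable {S : ObjectProperty TopCat.{u}} {Z Z' : Type} [TopologicalSpace Z] [TopologicalSpace Z']

theorem preimage_mem {A : Set Z'} (hA : A ∈ zeroProjections S Z') {f : Z → Z'}
    (hf : Continuous f) : f ⁻¹' A ∈ zeroProjections S Z := by
  obtain ⟨Y, hY, hne, G, hG, rfl⟩ := hA
  exact ⟨Y, hY, hne, fun r => G (f r.1, r.2), by fun_prop, rfl⟩

theorem eqNat_mem (hS : IsFunctionSpaceClass S) {f : Z → ℕ} (hf : Continuous f) (k : ℕ) :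
    {z | f z = k} ∈ zeroProjections S Z := by
  obtain ⟨X, hX, ⟨e⟩⟩ := hS.nat
  refine ⟨X, hX, ⟨e.symm 0⟩, fun r _ => if f r.1 = k then 0 else 1, ?_, ?_⟩
  · refine continuous_pi fun _ => ?_
    exact (continuous_of_discreteTopology (f := fun n : ℕ => if n = k then 0 else 1)).comp
      (hf.comp continuous_fst)
  · ext z
    by_cases h : f z = k
    · exact iff_of_true h ⟨e.symm 0, funext fun _ => if_pos h⟩
    · refine iff_of_false h fun ⟨_, hy⟩ => ?_
      simpa [h] using congrFun hy 0

/-- If `G (z, ·)` has no zero, a continuous `F : Y → ℕ` selects a coordinate where `G (z, y)` is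
nonzero. Such an `F` is a witness for the complement, and it need only be tested on a dense
sequence, so separate continuity of evaluation suffices. -/
theorem compl_mem (hS : IsFunctionSpaceClass S) {A : Set Z} (hA : A ∈ zeroProjections S Z) :
    Aᶜ ∈ zeroProjections S Z := by
  obtain ⟨Y, hY, hne, G, hG, rfl⟩ := hA
  have := hS.separable Y hY
  obtain ⟨d, hd⟩ := exists_dense_seq Y
  obtain ⟨E, hE, ev, hev, hev', hsurj⟩ := hS.functions Y hY
  obtain ⟨F₀, -⟩ := hsurj (fun _ => 0) continuous_const
  refine ⟨E, hE, ⟨F₀⟩,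
    fun r i => if G (r.1, d i) (ev r.2 (d i)) = 0 then 1 else 0, ?_, ?_⟩
  · refine continuous_pi fun i => ?_
    refine (continuous_of_discreteTopology (f := fun n : ℕ => if n = 0 then 1 else 0)).comp
      (continuous_baire_eval.comp (g := fun r : Baire × ℕ => r.1 r.2)
        (f := fun r : Z × E => (G (r.1, d i), ev r.2 (d i))) ?_)
    exact (hG.comp (continuous_fst.prodMk continuous_const)).prodMk
      ((hev' (d i)).comp continuous_snd)
  · ext z
    have hGz : Continuous fun y => G (z, y) := by fun_prop
    constructor
    · intro hz
      have hex : ∀ y, ∃ n, G (z, y) n ≠ 0 := fun y => by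
        by_contra! h
        exact hz ⟨y, funext h⟩
      classical
      -- The least nonzero coordinate is locally constant: each of its fibres is cut out by finitely
      -- many clopen conditions.
      have hcont : Continuous fun y => Nat.find (hex y) := by
        refine continuous_discrete_rng.2 fun n => ?_
        have heq : (fun y => Nat.find (hex y)) ⁻¹' {n} =
            (fun y => G (z, y)) ⁻¹' ({p | p n ≠ 0} ∩ ⋂ m ∈ Finset.range n, {p | p m = 0}) := by
          ext y
          simp [Nat.find_eq_iff]
        rw [heq]
        have hop : ∀ (m : ℕ) (s : Set ℕ), IsOpen {p : Baire | p m ∈ s} := fun m s =>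
          (isOpen_discrete s).preimage (continuous_apply m)
        exact ((hop n {0}ᶜ).inter
          (isOpen_biInter_finset fun m _ => hop m {0})).preimage hGz
      obtain ⟨F, hF⟩ := hsurj _ hcont
      refine ⟨F, funext fun i => if_neg ?_⟩
      rw [hF]
      exact Nat.find_spec (hex (d i))
    · rintro ⟨F, hF⟩ ⟨y, hy⟩
      have hcl : IsClosed {y | G (z, y) (ev F y) ≠ 0} :=
        (isClosed_discrete ({0}ᶜ : Set ℕ)).preimage
          (continuous_baire_eval.comp (hGz.prodMk (hev F)))
      have hrange : Set.range d ⊆ {y | G (z, y) (ev F y) ≠ 0} := by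
        rintro _ ⟨i, rfl⟩ h0
        simpa [h0] using congrFun hF i
      have hall := hcl.closure_subset_iff.2 hrange (hd y)
      exact hall (by rw [hy]; rfl)

theorem iInter_mem (hS : IsFunctionSpaceClass S) {A : ℕ → Set Z}
    (hA : ∀ n, A n ∈ zeroProjections S Z) : ⋂ n, A n ∈ zeroProjections S Z := by
  choose Y hY hne G hG hAG using hA
  obtain ⟨P, hP, π, hπ, hsurj⟩ := hS.pi ℕ Y hY
  obtain ⟨y₀, -⟩ := hsurj fun n => (hne n).some
  have hG' : ∀ n, Continuous fun r : Z × P => G n (r.1, π r.2 n) := fun n =>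
    (hG n).comp (continuous_fst.prodMk ((hπ n).comp continuous_snd))
  refine ⟨P, hP, ⟨y₀⟩, fun r k => G k.unpair.1 (r.1, π r.2 k.unpair.1) k.unpair.2, ?_, ?_⟩
  · exact continuous_pi fun k => (continuous_apply k.unpair.2).comp (hG' k.unpair.1)
  · ext z
    simp only [hAG, Set.mem_iInter, Set.mem_ofPred_eq]
    constructor
    · intro h
      choose y hy using h
      obtain ⟨p, rfl⟩ := hsurj y
      exact ⟨p, funext fun k => congrFun (hy _) _⟩
    · rintro ⟨p, hp⟩ n
      refine ⟨π p n, funext fun m => ?_⟩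
      have h : G (Nat.pair n m).unpair.1 (z, π p (Nat.pair n m).unpair.1)
        (Nat.pair n m).unpair.2 = 0 := congrFun hp (Nat.pair n m)
      rwa [Nat.unpair_pair] at h

theorem iUnion_mem (hS : IsFunctionSpaceClass S) {A : ℕ → Set Z}
    (hA : ∀ n, A n ∈ zeroProjections S Z) : ⋃ n, A n ∈ zeroProjections S Z := by
  rw [← compl_compl (⋃ n, A n), Set.compl_iUnion]
  exact hS.compl_mem (hS.iInter_mem fun n => hS.compl_mem (hA n))

theorem inter_mem (hS : IsFunctionSpaceClass S) {A B : Set Z}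
    (hA : A ∈ zeroProjections S Z) (hB : B ∈ zeroProjections S Z) :
    A ∩ B ∈ zeroProjections S Z := by
  have h : A ∩ B = ⋂ n : ℕ, if n = 0 then A else B := by
    ext z
    simp only [Set.mem_inter_iff, Set.mem_iInter]
    refine ⟨fun h n => ?_, fun h => ⟨by simpa using h 0, by simpa using h 1⟩⟩
    split_ifs
    exacts [h.1, h.2]
  rw [h]
  refine hS.iInter_mem fun n => ?_
  split_ifs
  exacts [hA, hB]

theorem projection_mem (hS : IsFunctionSpaceClass S) {A : Set (Baire × Z)}
    (hA : A ∈ zeroProjections S (Baire × Z)) :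
    {z | ∃ p, (p, z) ∈ A} ∈ zeroProjections S Z := by
  obtain ⟨Y, hY, ⟨y₀⟩, G, hG, rfl⟩ := hA
  obtain ⟨X, hX, ⟨e⟩⟩ := hS.nat
  -- The product of `Y` with countably many copies of `ℕ` absorbs the quantifier over `Baire` into
  -- the witness space.
  let F : Option ℕ → TopCat.{u} := fun o => Option.rec Y (fun _ => X) o
  obtain ⟨P, hP, π, hπ, hsurj⟩ := hS.pi (Option ℕ) F (by rintro (_ | n); exacts [hY, hX])
  let π₀ : P → Y := fun x => π x none
  let π₁ : P → Baire := fun x n => e (π x (some n))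
  have hπ₀ : Continuous π₀ := hπ none
  have hπ₁ : Continuous π₁ := continuous_pi fun n =>
    e.continuous.comp (hπ (some n))
  have hex : ∀ (p : Baire) (y : Y), ∃ x, π₁ x = p ∧ π₀ x = y := fun p y => by
    obtain ⟨x, hx⟩ := hsurj fun o => Option.rec y (fun n => e.symm (p n)) o
    exact ⟨x, by simp [π₁, hx], by simp [π₀, hx]⟩
  obtain ⟨x₀, -⟩ := hex 0 y₀
  refine ⟨P, hP, ⟨x₀⟩, fun r => G ((π₁ r.2, r.1), π₀ r.2), by fun_prop, ?_⟩
  · ext z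
    constructor
    · rintro ⟨p, y, h⟩
      obtain ⟨x, rfl, rfl⟩ := hex p y
      exact ⟨x, h⟩
    · rintro ⟨x, hx⟩
      exact ⟨_, _, hx⟩

end IsFunctionSpaceClass

/-! ### Universal sets -/

/-- The pairing of the Baire space. -/
def bairePair : Baire × Baire ≃ₜ Baire :=
  Homeomorph.sumArrowHomeomorphProdArrow.symm.trans
    (Homeomorph.piCongrLeft (Y := fun _ => ℕ) Equiv.natSumNatEquivNat)

/-- The `n`-th row of an element of the Baire space. -/
def row (e : Baire) (n : ℕ) : Baire := fun m => e (Nat.pair n m)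

theorem continuous_row (n : ℕ) : Continuous fun e => row e n :=
  continuous_pi fun m => continuous_apply (Nat.pair n m)

theorem exists_rows (f : ℕ → Baire) : ∃ e, ∀ n, row e n = f n :=
  ⟨fun k => f k.unpair.1 k.unpair.2, fun n => by ext m; simp [row]⟩

/-- On every copy of the Baire space, the sets of the family `Γ` are the sections of a single
projection of a zero set along a space of the class `S`. -/
def HasUniversal (S : ObjectProperty TopCat.{u}) (Γ : SetFamily.{0}) : Prop :=
  ∀ (Y : Type) [TopologicalSpace Y] (h : Y ≃ₜ Baire),
    ∃ U ∈ zeroProjections S (Baire × Baire), ∀ A ∈ Γ Y, ∃ e, ∀ y, y ∈ A ↔ (e, h y) ∈ U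

namespace HasUniversal

open IsFunctionSpaceClass

variable {S : ObjectProperty TopCat.{u}} {Γ : SetFamily.{0}}

theorem opens (hS : IsFunctionSpaceClass S) : HasUniversal S SetFamily.opens := by
  intro Y _ h
  have hres : ∀ n, Continuous fun x : Baire => Encodable.encode (PiNat.res x n) := by
    intro n
    refine continuous_discrete_rng.2 fun k => isOpen_iff_mem_nhds.2 fun x hx => ?_
    filter_upwards [(PiNat.isOpen_cylinder (fun _ => ℕ) x n).mem_nhds
      (PiNat.self_mem_cylinder x n)] with y hy
    rw [PiNat.cylinder_eq_res] at hy
    have hy' : PiNat.res y n = PiNat.res x n := hy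
    simpa [hy'] using hx
  refine ⟨⋃ n, {r | r.1 (Encodable.encode (PiNat.res r.2 n)) = 0}, hS.iUnion_mem fun n =>
    hS.eqNat_mem (continuous_baire_eval.comp
      (continuous_fst.prodMk ((hres n).comp continuous_snd))) 0, fun A hA => ?_⟩
  classical
  -- The code of an open set marks with `0` the finite sequences whose cylinder it contains.
  refine ⟨fun k => if ∃ x n, k = Encodable.encode (PiNat.res x n) ∧
    h.symm '' PiNat.cylinder x n ⊆ A then 0 else 1, fun y => ?_⟩
  simp only [Set.mem_iUnion, Set.mem_ofPred_eq, ite_eq_left_iff, one_ne_zero, imp_false, not_not]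
  constructor
  · intro hy
    have hop : IsOpen (h.symm ⁻¹' A) := IsOpen.preimage h.symm.continuous hA
    obtain ⟨_, ⟨x, n, rfl⟩, hmem, hsub⟩ :=
      (PiNat.isTopologicalBasis_cylinders fun _ => ℕ).exists_subset_of_mem_open
        (a := h y) (by simpa using hy) hop
    rw [← PiNat.mem_cylinder_iff_eq.1 hmem] at hsub
    exact ⟨n, h y, n, rfl, Set.image_subset_iff.2 hsub⟩
  · rintro ⟨n, x, m, heq, hsub⟩
    have heq := Encodable.encode_injective heq
    obtain rfl : n = m := by simpa using congrArg List.length heq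
    refine hsub ⟨h y, ?_, by simp⟩
    rw [PiNat.cylinder_eq_res]
    exact heq

theorem compls (hS : IsFunctionSpaceClass S) (hΓ : HasUniversal S Γ) :
    HasUniversal S Γ.compls := by
  intro Y _ h
  obtain ⟨U, hU, huniv⟩ := hΓ Y h
  refine ⟨Uᶜ, hS.compl_mem hU, fun A hA => ?_⟩
  obtain ⟨e, he⟩ := huniv Aᶜ hA
  exact ⟨e, fun y => by simpa using not_congr (he y)⟩

theorem diffs (hS : IsFunctionSpaceClass S) (hΓ : HasUniversal S Γ) :
    HasUniversal S Γ.diffs := by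
  intro Y _ h
  obtain ⟨U, hU, huniv⟩ := hΓ Y h
  have hrow : ∀ n, Continuous fun r : Baire × Baire => (row r.1 n, r.2) := fun n =>
    ((continuous_row n).comp continuous_fst).prodMk continuous_snd
  refine ⟨_, hS.inter_mem (preimage_mem hU (hrow 0)) (hS.compl_mem (preimage_mem hU (hrow 1))), ?_⟩
  rintro _ ⟨B, hB, C, hC, rfl⟩
  obtain ⟨b, hb⟩ := huniv B hB
  obtain ⟨c, hc⟩ := huniv C hC
  obtain ⟨e, he⟩ := exists_rows fun n => if n = 0 then b else c
  exact ⟨e, fun y => by simp [he, hb, hc]⟩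

theorem countableUnions (hS : IsFunctionSpaceClass S) (hΓ : HasUniversal S Γ) :
    HasUniversal S Γ.countableUnions := by
  intro Y _ h
  obtain ⟨U, hU, huniv⟩ := hΓ Y h
  refine ⟨_, hS.iUnion_mem fun n => preimage_mem hU
    (((continuous_row n).comp continuous_fst).prodMk continuous_snd), ?_⟩
  rintro _ ⟨B, hB, rfl⟩
  choose b hb using fun n => huniv (B n) (hB n)
  obtain ⟨e, he⟩ := exists_rows b
  exact ⟨e, fun y => by simp [he, hb]⟩

theorem countableInters (hS : IsFunctionSpaceClass S) (hΓ : HasUniversal S Γ) :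
    HasUniversal S Γ.countableInters := by
  intro Y _ h
  obtain ⟨U, hU, huniv⟩ := hΓ Y h
  refine ⟨_, hS.iInter_mem fun n => preimage_mem hU
    (((continuous_row n).comp continuous_fst).prodMk continuous_snd), ?_⟩
  rintro _ ⟨B, hB, rfl⟩
  choose b hb using fun n => huniv (B n) (hB n)
  obtain ⟨e, he⟩ := exists_rows b
  exact ⟨e, fun y => by simp [he, hb]⟩

theorem projections (hS : IsFunctionSpaceClass S) (hΓ : HasUniversal S Γ) :
    HasUniversal S Γ.projections := by
  intro Y _ h
  obtain ⟨U, hU, huniv⟩ := hΓ (Baire × Y)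
    (((Homeomorph.refl Baire).prodCongr h).trans bairePair)
  refine ⟨_, hS.projection_mem (preimage_mem (Z := Baire × Baire × Baire)
    (f := fun r => (r.2.1, bairePair (r.1, r.2.2))) hU (by fun_prop)), ?_⟩
  rintro _ ⟨B, hB, rfl⟩
  obtain ⟨e, he⟩ := huniv B hB
  exact ⟨e, fun y => by simp [he]⟩

/-- A code carries the index `n` of its family in row `0` and a code for that family in row `1`. -/
theorem iUnion (hS : IsFunctionSpaceClass S) {Γ : ℕ → SetFamily.{0}}
    (hΓ : ∀ n, HasUniversal S (Γ n)) : HasUniversal S (fun X _ => ⋃ n, Γ n X) := by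
  intro Y _ h
  choose U hU huniv using fun n => hΓ n Y h
  refine ⟨⋃ n, {r | row r.1 0 0 = n} ∩ (fun r => (row r.1 1, r.2)) ⁻¹' U n,
    hS.iUnion_mem fun n => hS.inter_mem (hS.eqNat_mem ?_ n) (preimage_mem (hU n) ?_), ?_⟩
  · exact (continuous_apply 0).comp ((continuous_row 0).comp continuous_fst)
  · exact ((continuous_row 1).comp continuous_fst).prodMk continuous_snd
  intro A hA
  obtain ⟨n, hn⟩ := Set.mem_iUnion.1 hA
  obtain ⟨b, hb⟩ := huniv n A hn
  obtain ⟨e, he⟩ := exists_rows fun k => if k = 0 then fun _ => n else b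
  exact ⟨e, fun y => by simp [he, hb]⟩

theorem sigmaOne (hS : IsFunctionSpaceClass S) (α : Ordinal.{0}) (hα : α < Ordinal.omega 1) :
    HasUniversal S (sigmaOne α) := by
  induction α using Ordinal.limitRecOn with
  | zero =>
    rw [sigmaOne_zero]
    exact ((opens hS).diffs hS).countableUnions hS
  | add_one α ih =>
    rw [sigmaOne_add_one]
    exact ((ih ((lt_add_one α).trans hα)).compls hS).projections hS
  | limit l hl ih =>
    rw [sigmaOne_limit l hl]
    have hcount : (Set.Iio l).Countable := by
      rw [← Cardinal.ord_aleph, Cardinal.lt_ord, Cardinal.lt_aleph_one_iff] at hα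
      rwa [← Cardinal.le_aleph0_iff_set_countable, Cardinal.mk_Iio_ordinal,
        Cardinal.lift_le_aleph0]
    -- Since `l` is countable, the levels below it can be enumerated by `ℕ`, which reduces the limit
    -- case to `iUnion`.
    have hne : (Set.Iio l).Nonempty := ⟨0, hl.bot_lt⟩
    obtain ⟨a, ha⟩ := hcount.exists_eq_range hne
    have hmem : ∀ n, a n < l := fun n => by
      have : a n ∈ Set.Iio l := ha ▸ Set.mem_range_self n
      exact this
    have heq : (fun (X : Type) [TopologicalSpace X] =>
        ⋃ (b : Ordinal.{0}) (_ : b < l), QCBHierarchy.sigmaOne b X) =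
        fun (X : Type) [TopologicalSpace X] => ⋃ n, QCBHierarchy.sigmaOne (a n) X := by
      funext X _
      have : (⋃ b ∈ Set.Iio l, QCBHierarchy.sigmaOne b X) =
          ⋃ n, QCBHierarchy.sigmaOne (a n) X := by rw [ha, Set.biUnion_range]
      exact this
    rw [heq]
    exact ((iUnion hS fun n => ih (a n) (hmem n) ((hmem n).trans hα)).countableInters
      hS).projections hS

end HasUniversal

/-! ### The diagonal argument -/

/-- A class of spaces with countable products and function spaces into `ℕ` does not consist of
`Γ`-representable spaces, if `Γ` admits universal sets. -/
theorem IsFunctionSpaceClass.not_forall_isRepresentable {S : ObjectProperty TopCat.{u}}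
    (hS : IsFunctionSpaceClass S) {Γ : SetFamily.{0}} (hΓ : HasUniversal S Γ) :
    ¬ ∀ X : TopCat.{u}, S X → IsRepresentable Γ X := by
  intro hrep
  obtain ⟨U, hU, hUuniv⟩ := hΓ (Baire × Baire) bairePair
  obtain ⟨V, hV, hVuniv⟩ := (HasUniversal.opens hS).compls hS (Baire × Baire) bairePair
  -- Row `0` codes `EQ(δ)`, whose diagonal is the domain of `δ`; row `1` codes a closed set of
  -- pairs.
  let W : Set (Baire × Baire) := {r | ∃ p, (row r.1 0, bairePair (p, p)) ∈ U ∧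
    (row r.1 1, bairePair (p, r.2)) ∈ V}
  have hrow : ∀ n, Continuous fun r : Baire × Baire × Baire => row r.2.1 n := fun n =>
    (continuous_row n).comp (continuous_fst.comp continuous_snd)
  have hW : W ∈ zeroProjections S (Baire × Baire) :=
    hS.projection_mem
      (A := {r : Baire × Baire × Baire | (row r.2.1 0, bairePair (r.1, r.1)) ∈ U} ∩
        {r : Baire × Baire × Baire | (row r.2.1 1, bairePair (r.1, r.2.2)) ∈ V})
      (hS.inter_mem (IsFunctionSpaceClass.preimage_mem hU ((hrow 0).prodMk (by fun_prop)))
        (IsFunctionSpaceClass.preimage_mem hV ((hrow 1).prodMk (by fun_prop))))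
  have hdiag : {x : Baire | (x, x) ∉ W} ∈ zeroProjections S Baire :=
    hS.compl_mem (IsFunctionSpaceClass.preimage_mem hW (f := fun x => (x, x)) (by fun_prop))
  obtain ⟨Y, hY, -, G, hG, hGW⟩ := hdiag
  obtain ⟨D, δ, hδ, hEQ⟩ := hrep Y hY
  let T : Set (Baire × Baire) := {r | ∃ hp : r.1 ∈ D, G (r.2, δ ⟨r.1, hp⟩) = 0}
  obtain ⟨a, ha⟩ := hUuniv _ hEQ
  obtain ⟨b, hb⟩ := hVuniv (closure T)
    (show IsOpen (closure T)ᶜ from isClosed_closure.isOpen_compl)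
  obtain ⟨e, he⟩ := exists_rows fun n => if n = 0 then a else b
  -- `T` is relatively closed in `D × Baire`, so its closure adds no points over `D`.
  have hclosure : ∀ r ∈ closure T, ∀ hp : r.1 ∈ D, G (r.2, δ ⟨r.1, hp⟩) = 0 := by
    intro r hr hp
    have hcl : IsClosed {s : D × Baire | G (s.2, δ s.1) = 0} :=
      isClosed_singleton.preimage
        (hG.comp (continuous_snd.prodMk (hδ.continuous.comp continuous_fst)))
    have hind : Topology.IsInducing fun s : D × Baire => ((s.1 : Baire), s.2) :=
      Topology.IsInducing.subtypeVal.prodMap Topology.IsInducing.id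
    have hmem : ((⟨r.1, hp⟩, r.2) : D × Baire) ∈ closure {s : D × Baire | G (s.2, δ s.1) = 0} := by
      rw [hind.closure_eq_preimage_closure_image]
      refine closure_mono ?_ hr
      rintro s ⟨hs, h0⟩
      exact ⟨(⟨s.1, hs⟩, s.2), h0, rfl⟩
    exact hcl.closure_subset hmem
  have key : (e, e) ∈ W ↔ ∃ y, G (e, y) = 0 := by
    simp only [W, Set.mem_ofPred_eq, he, if_true, one_ne_zero, if_false, ← ha, ← hb]
    constructor
    · rintro ⟨p, ⟨hp, -⟩, hT⟩
      exact ⟨_, hclosure _ hT hp⟩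
    · rintro ⟨y, hy⟩
      obtain ⟨⟨p, hp⟩, rfl⟩ := hδ.surjective y
      exact ⟨p, ⟨hp, hp, rfl⟩, subset_closure ⟨hp, hy⟩⟩
  have hdiag' : (e, e) ∉ W ↔ ∃ y, G (e, y) = 0 := Set.ext_iff.1 hGW e
  exact iff_not_self (key.trans hdiag'.symm)

/-! ### Full subcategories of `QCB0` -/

open MonoidalCategory CartesianMonoidalCategory

variable {C : ObjectProperty QCB0.{u}}

/-- The class of the underlying spaces of the objects of a full subcategory of `QCB0`. -/
def underlyingSpaces (C : ObjectProperty QCB0.{u}) : ObjectProperty TopCat.{u} := fun X =>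
  ∃ h : isQCB0 X, C ⟨X, h⟩

theorem separableSpace_of_isQCB0 {X : TopCat.{u}} (hX : isQCB0 X) : SeparableSpace X := by
  obtain ⟨-, Z, _, q, _, hq⟩ := hX
  exact hq.separableSpace

/-- The underlying space of an object of a full subcategory of `QCB0`. -/
abbrev space (X : C.FullSubcategory) : TopCat.{u} := X.obj.obj

/-- The underlying function of a morphism. -/
def toFun {X Y : C.FullSubcategory} (f : X ⟶ Y) : space X → space Y := f.hom.hom

theorem continuous_toFun {X Y : C.FullSubcategory} (f : X ⟶ Y) : Continuous (toFun f) :=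
  f.hom.hom.hom.continuous

/-- The morphism given by a continuous function between the underlying spaces. -/
def ofContinuous {X Y : C.FullSubcategory} (f : space X → space Y) (hf : Continuous f) : X ⟶ Y :=
  ObjectProperty.homMk (ObjectProperty.homMk (TopCat.ofHom ⟨f, hf⟩))

/-- The constant morphism. -/
def constHom (X : C.FullSubcategory) {Y : C.FullSubcategory} (y : space Y) : X ⟶ Y :=
  ofContinuous (fun _ => y) continuous_const

theorem constHom_comp {X Y Z : C.FullSubcategory} (y : space Y) (g : Y ⟶ Z) :
    constHom X y ≫ g = constHom X (toFun g y) := rfl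

theorem constHom_injective {X Y : C.FullSubcategory} (x : space X) {y y' : space Y}
    (h : constHom X y = constHom X y') : y = y' :=
  congrArg (fun f : X ⟶ Y => toFun f x) h

/-- Points of the abstract product are compared through constant morphisms, so its underlying space
need not be identified. This yields separate continuity of evaluation. -/
theorem toFun_lift_constHom [CartesianMonoidalCategory C.FullSubcategory]
    {E Y : C.FullSubcategory} (F : space E) (y : space Y) :
    toFun (lift (constHom Y F) (𝟙 Y)) y = toFun (lift (𝟙 E) (constHom E y)) F := by
  refine constHom_injective (X := Y) y ?_
  rw [← constHom_comp, ← constHom_comp, comp_lift, comp_lift]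
  rfl

/-- A full cartesian closed subcategory of `QCB0` which inherits countable products and contains
the discrete space of natural numbers is closed under function spaces. -/
theorem isFunctionSpaceClass_underlyingSpaces (hccc : IsCartesianClosed C.FullSubcategory)
    (hprod : InheritsCountableProducts C) (hnat : ContainsNat C) :
    IsFunctionSpaceClass (underlyingSpaces C) where
  separable := fun X ⟨h, _⟩ => separableSpace_of_isQCB0 h
  nat := by
    obtain ⟨X, hX, e⟩ := hnat
    exact ⟨X.obj, ⟨X.property, hX⟩, e⟩
  pi := by
    intro J _ X hX
    obtain ⟨N, hN, ⟨e⟩⟩ := hnat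
    choose hq hC using hX
    obtain ⟨P, ⟨hP⟩, hPC⟩ := hprod J (fun j => ⟨X j, hq j⟩) hC
    refine ⟨P.pt.obj, ⟨P.pt.property, hPC⟩, fun p j => (P.proj j).hom p,
      fun j => (P.proj j).hom.hom.continuous, fun x => ?_⟩
    -- A cone of constant maps out of the nonempty space `N` hits the prescribed point `x`.
    let c : Fan fun j => (⟨X j, hq j⟩ : QCB0.{u}) :=
      Fan.mk N fun j => ObjectProperty.homMk (TopCat.ofHom (ContinuousMap.const _ (x j)))
    refine ⟨(hP.lift c).hom (e.symm 0), funext fun j => ?_⟩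
    exact congrArg (fun f : N ⟶ (⟨X j, hq j⟩ : QCB0.{u}) => f.hom (e.symm 0)) (hP.fac c ⟨j⟩)
  functions := by
    rintro Y₀ ⟨hq, hC⟩
    obtain ⟨_, ⟨_⟩⟩ := hccc
    obtain ⟨N₀, hN, ⟨e⟩⟩ := hnat
    let Y : C.FullSubcategory := ⟨⟨Y₀, hq⟩, hC⟩
    let N : C.FullSubcategory := ⟨N₀, hN⟩
    let E : C.FullSubcategory := (ihom Y).obj N
    let ε : Y ⊗ E ⟶ N := (ihom.ev Y).app N
    have hev : ∀ (F : space E) (y : space Y),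
        toFun (lift (𝟙 Y) (constHom Y F) ≫ ε) y = toFun (lift (constHom E y) (𝟙 E) ≫ ε) F :=
      fun F y => congrArg (toFun ε) (toFun_lift_constHom y F).symm
    refine ⟨space E, ⟨E.obj.property, E.property⟩,
      fun F y => e (toFun (lift (𝟙 Y) (constHom Y F) ≫ ε) y),
      fun F => e.continuous.comp (continuous_toFun _), fun y => ?_, fun f hf => ?_⟩
    · simp only [hev]
      exact e.continuous.comp (continuous_toFun _)
    · let g : Y ⟶ N := ofContinuous (fun y => e.symm (f y)) (e.symm.continuous.comp hf)
      let a : space N := e.symm 0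
      -- Currying over `N` instead of the unit object supplies an explicit point `a` at which to
      -- evaluate.
      let k : N ⟶ E := MonoidalClosed.curry (fst Y N ≫ g)
      refine ⟨toFun k a, funext fun y => ?_⟩
      have hk : lift (𝟙 Y) (constHom Y (toFun k a)) ≫ ε = g := by
        calc lift (𝟙 Y) (constHom Y (toFun k a)) ≫ ε
            = lift (𝟙 Y) (constHom Y a) ≫ (Y ◁ k ≫ ε) := by
              rw [← constHom_comp, lift_whiskerLeft_assoc]
          _ = lift (𝟙 Y) (constHom Y a) ≫ (fst Y N ≫ g) := by
              rw [← MonoidalClosed.uncurry_eq, MonoidalClosed.uncurry_curry]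
          _ = g := by simp
      change e (toFun (lift (𝟙 Y) (constHom Y (toFun k a)) ≫ ε) y) = f y
      rw [hk]
      exact e.apply_symm_apply _

end QCBHierarchy

theorem corollary7p4 :
    ¬ ∃ C : ObjectProperty QCBHierarchy.QCB0.{u},
      QCBHierarchy.IsCartesianClosed C.FullSubcategory ∧
      QCBHierarchy.InheritsCountableProducts C ∧
      QCBHierarchy.ContainsNat C ∧
      ∃ α : Ordinal.{0}, α < Ordinal.omega 1 ∧
        C ≤ QCBHierarchy.representableQCB0 (QCBHierarchy.sigmaOne α) := by
  rintro ⟨C, hccc, hprod, hnat, α, hα, hrep⟩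
  have hS := QCBHierarchy.isFunctionSpaceClass_underlyingSpaces hccc hprod hnat
  exact hS.not_forall_isRepresentable (QCBHierarchy.HasUniversal.sigmaOne hS α hα)
    fun X ⟨h, hX⟩ => hrep ⟨X, h⟩ hX
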